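/- A \emph{loop} is a set $Q$ with a binary operation and a two-sided identity $1$ such that all left translations $L_a : x \mapsto ax$ and all right translations $R_a : x \mapsto xa$ are bijections of $Q$. A loop is an \emph{extra loop} if it is conjugacy closed (each of the sets $\{L_a : a\in Q\}$ and $\{R_a : a \in Q\}$ is closed under conjugation by its own elements) and Moufang ($xy\cdot zx = (x\cdot yz)\cdot x$ for all $x,y,z$). Let $\mathrm{RMlt}(Q)$ be the group generated by all $R_a$, let $\mathrm{RMlt}_1$ be the stabilizer of $1$ in it, and for $S \subseteq Q$ let $R(S)=\{R_a : a\in S\}$ and let $\mathrm{RMlt}_1\cdot R(S)$ be the set of all permutations $x \mapsto h(x)\,a$ with $h\in \mathrm{RMlt}_1$, $a \in S$. Let $A=A(Q)$ be the subloop generated by all associators $(x,y,z)$, defined by $(x\cdot yz)(x,y,z)=xy\cdot z$, and let $A^*=\{g\in \mathrm{RMlt}(Q) : g(x)\in Ax \text{ for all } x\in Q\}$. For a prime $p$, a $p$-subloop is a subloop whose order is a power of $p$ (including $p^0=1$), and a Sylow $p$-subloop of a finite loop $Q$ is a subloop whose order is the largest power of $p$ dividing $|Q|$; $\mathrm{Syl}_p$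 denotes the set of Sylow $p$-subloops of a finite loop, or of Sylow $p$-subgroups of a finite group. \textbf{Corollary.} Let $Q$ be a finite extra loop. For every prime $p$, $\mathrm{Syl}_p(Q)$ is in one-to-one correspondence with $\mathrm{Syl}_p(\mathrm{RMlt}(Q))$. Explicitly, $P\mapsto R(P)$ is a bijection from $\mathrm{Syl}_p(Q)$ onto $\mathrm{Syl}_p(\mathrm{RMlt}(Q))$ if $p$ is odd, and $P\mapsto \mathrm{RMlt}_1\cdot R(P)$ is such a bijection if $p=2$. Moreover, $S\mapsto R(S)$ is a bijection from the subloops of $Q$ of odd order onto the subgroups of $\mathrm{RMlt}(Q)$ of odd order, and $P\mapsto \mathrm{RMlt}_1\cdot R(P)$ is a bijection from the $2$-subloops of $Q$ containing $A$ onto the $2$-subgroups of $\mathrm{RMlt}(Q)$ containing $A^*$. -/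

import Mathlib

/-- A loop: a set with a binary operation and a two-sided identity element `1` in which all
left translations `x ↦ a * x` and all right translations `x ↦ x * a` are bijective. -/
class Loop (Q : Type*) extends MulOneClass Q where
  mul_left_bijective : ∀ a : Q, Function.Bijective (fun x : Q => a * x)
  mul_right_bijective : ∀ a : Q, Function.Bijective (fun x : Q => x * a)

namespace Loop

variable {Q : Type*} [Loop Q]

/-- The left translation `L_a : x ↦ a * x`, as a permutation of the loop. -/
noncomputable def leftTranslation (a : Q) : Equiv.Perm Q :=
  Equiv.ofBijective (fun x : Q => a * x) (mul_left_bijective a)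

/-- The right translation `R_a : x ↦ x * a`, as a permutation of the loop. -/
noncomputable def rightTranslation (a : Q) : Equiv.Perm Q :=
  Equiv.ofBijective (fun x : Q => x * a) (mul_right_bijective a)

end Loop

open Loop

/-- A loop is conjugacy closed (a CC-loop) if its set of left translations and its set of right
translations are each closed under conjugation by their own elements. -/
def IsConjugacyClosed (Q : Type*) [Loop Q] : Prop :=
  (∀ x y : Q, leftTranslation x * leftTranslation y * (leftTranslation x)⁻¹ ∈
      Set.range (leftTranslation : Q → Equiv.Perm Q)) ∧
  (∀ x y : Q, rightTranslation x * rightTranslation y * (rightTranslation x)⁻¹ ∈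
      Set.range (rightTranslation : Q → Equiv.Perm Q))

/-- The Moufang identity `xy · zx = (x · yz) · x`. -/
def IsMoufang (Q : Type*) [Loop Q] : Prop :=
  ∀ x y z : Q, (x * y) * (z * x) = (x * (y * z)) * x

/-- An extra loop is a loop that is both conjugacy closed and Moufang. -/
def IsExtraLoop (Q : Type*) [Loop Q] : Prop :=
  IsConjugacyClosed Q ∧ IsMoufang Q

/-- A subloop: a subset containing `1` and closed under multiplication and under
left and right division. -/
@[ext]
structure Subloop (Q : Type*) [Loop Q] where
  carrier : Set Q
  one_mem' : (1 : Q) ∈ carrier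
  mul_mem' : ∀ {a b : Q}, a ∈ carrier → b ∈ carrier → a * b ∈ carrier
  mem_of_mul_mem_left' : ∀ {a b : Q}, a ∈ carrier → a * b ∈ carrier → b ∈ carrier
  mem_of_mul_mem_right' : ∀ {a b : Q}, b ∈ carrier → a * b ∈ carrier → a ∈ carrier

namespace Subloop

variable {Q : Type*} [Loop Q]

instance : SetLike (Subloop Q) Q where
  coe := Subloop.carrier
  coe_injective := by
    intro S T h
    exact Subloop.ext h

instance : PartialOrder (Subloop Q) := PartialOrder.ofSetLike (Subloop Q) Q

/-- The subloop generated by a set: the intersection of all subloops containing it. -/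
def closure (X : Set Q) : Subloop Q where
  carrier := {x | ∀ S : Subloop Q, X ⊆ (S : Set Q) → x ∈ S}
  one_mem' := fun S _ => S.one_mem'
  mul_mem' := fun ha hb S hS => S.mul_mem' (ha S hS) (hb S hS)
  mem_of_mul_mem_left' := fun ha hab S hS => S.mem_of_mul_mem_left' (ha S hS) (hab S hS)
  mem_of_mul_mem_right' := fun hb hab S hS => S.mem_of_mul_mem_right' (hb S hS) (hab S hS)

end Subloop

/-- The subloop `A(Q)` generated by all associators; the associator of `x`, `y`, `z` is the unique
`c` with `(x · yz) · c = xy · z`. -/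
def associatorSubloop (Q : Type*) [Loop Q] : Subloop Q :=
  Subloop.closure {c : Q | ∃ x y z : Q, (x * (y * z)) * c = (x * y) * z}

/-- A Sylow `p`-subloop of a finite loop `Q`: a subloop whose order is the exact power of `p`
in the order of `Q`. -/
def SylowSubloop (p : ℕ) (Q : Type*) [Loop Q] : Type _ :=
  {P : Subloop Q // Nat.card P = p ^ (Nat.card Q).factorization p}

/-- The right multiplication group, generated by all right translations. (Permutations are
composed here from right to left; composing them from left to right gives the opposite group,
with the same underlying set and the same subgroups.) -/
def RMlt (Q : Type*) [Loop Q] : Subgroup (Equiv.Perm Q) :=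
  Subgroup.closure (Set.range (rightTranslation : Q → Equiv.Perm Q))

/-- The right inner mapping group: the stabilizer of `1` in `RMlt Q`. -/
def RMltOne (Q : Type*) [Loop Q] : Subgroup (RMlt Q) :=
  MulAction.stabilizer (RMlt Q) (1 : Q)

/-- `R(S) = {R_a : a ∈ S}`, as a subset of `RMlt Q`. -/
def rightTranslationSet {Q : Type*} [Loop Q] (S : Set Q) : Set (RMlt Q) :=
  {g | ∃ a ∈ S, (g : Equiv.Perm Q) = rightTranslation a}

/-- `RMlt₁ · R(S)`: all permutations `x ↦ h(x) * a`, "first `h ∈ RMlt₁`, then `R_a`"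
with `a ∈ S`. -/
def innerMulRightTranslationSet {Q : Type*} [Loop Q] (S : Set Q) : Set (RMlt Q) :=
  {g | ∃ h ∈ RMltOne Q, ∃ a ∈ S, (g : Equiv.Perm Q) = rightTranslation a * (h : Equiv.Perm Q)}

/-- `A* = {g ∈ RMlt Q : g(x) ∈ A(Q) x for all x}`. -/
def associatorStar (Q : Type*) [Loop Q] : Set (RMlt Q) :=
  {g | ∀ x : Q, ∃ a ∈ associatorSubloop Q, (g : Equiv.Perm Q) x = a * x}

/-! In an extra loop every square is nuclear, so modulo the nucleus `N` the loop is a group of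
exponent 2. Hence all associators lie in `N` and depend only on cosets of `N`. They also commute
with `N`, are symmetric and have square `1` (`asc_mul_comm_of_isNuclear`, `asc_swap_left`,
`asc_mul_self`). So `A` lies in the center of `N`, has exponent 2, and is stable under conjugation
by all of `Q` (`conj_mem`).

On the group side, every `g` in `RMlt Q` satisfies `g x = a * (x * g 1)` with `a ∈ A` (`map_eq`):
evaluation at `1` is an anti-homomorphism up to `A`. Its fibre over `1` is `RMlt₁`, its fibre over
`A` is `A*`, and `A*` is a normal 2-group. Hence subgroups containing `A*` are exactly the preimages
of subloops containing `A`. Every Sylow 2-subgroup contains `A*`, and every Sylow 2-subloop contains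
`A`, since otherwise `A P` would be too large a 2-subloop.

Odd order forces nuclearity, because squares are nuclear: a subloop of odd order lies in `N`
(`isNuclear_of_odd_card`), and a subgroup of odd order consists of translations by nuclear elements
(`exists_eq_rTrans_of_odd`). On `N` the map `R` reverses products, so it matches subloops with
subgroups. The Sylow statements follow from `|RMlt| = |RMlt₁| |Q|`, with `|RMlt₁|` a power of 2. -/

namespace Loop

variable {Q : Type*} [Loop Q]

@[simp] theorem leftTranslation_apply (a x : Q) : leftTranslation a x = a * x := rfl

@[simp] theorem rightTranslation_apply (a x : Q) : rightTranslation a x = x * a := rfl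

theorem left_cancel_iff {a b c : Q} : a * b = a * c ↔ b = c :=
  (mul_left_bijective a).1.eq_iff

theorem right_cancel_iff {a b c : Q} : b * a = c * a ↔ b = c :=
  (mul_right_bijective a).1.eq_iff

/-- The right inverse of an element of a loop. -/
noncomputable instance : Inv Q := ⟨fun x => (leftTranslation x).symm 1⟩

@[simp] theorem mul_inv_self (x : Q) : x * x⁻¹ = 1 := (leftTranslation x).apply_symm_apply 1

end Loop

/-! ### Inverse property, Moufang, alternative and extra identities. -/

namespace ExtraLoop

variable {Q : Type*} [Loop Q] [hQ : Fact (IsExtraLoop Q)]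

theorem moufang (x y z : Q) : (x * y) * (z * x) = (x * (y * z)) * x := hQ.out.2 x y z

theorem flexible (x y : Q) : x * (y * x) = (x * y) * x := by
  simpa using moufang x 1 y

@[simp] theorem mul_inv_cancel_left (x z : Q) : x * (x⁻¹ * z) = z := by
  have := moufang x x⁻¹ z
  rw [mul_inv_self, one_mul, right_cancel_iff] at this
  exact this.symm

@[simp] theorem inv_mul_self (x : Q) : x⁻¹ * x = 1 := by
  rw [← left_cancel_iff (a := x)]; simp

@[simp] theorem inv_inv (x : Q) : x⁻¹⁻¹ = x := by
  rw [← left_cancel_iff (a := x⁻¹)]; simp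

@[simp] theorem inv_mul_cancel_left (x z : Q) : x⁻¹ * (x * z) = z := by
  simpa using mul_inv_cancel_left x⁻¹ z

@[simp] theorem inv_mul_cancel_right (x y : Q) : (y * x⁻¹) * x = y := by
  have := moufang x y x⁻¹
  rw [inv_mul_self, mul_one, ← flexible, left_cancel_iff] at this
  exact this.symm

@[simp] theorem mul_inv_cancel_right (x y : Q) : (y * x) * x⁻¹ = y := by
  simpa using inv_mul_cancel_right x⁻¹ y

@[simp] theorem mul_inv_rev (x y : Q) : (x * y)⁻¹ = y⁻¹ * x⁻¹ := by
  have h : y⁻¹ = (x * y)⁻¹ * x := by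
    rw [← left_cancel_iff (a := x * y)]; simp
  rw [h]; simp

@[simp] theorem one_inv {Q : Type*} [Loop Q] : (1 : Q)⁻¹ = 1 := by
  have h := mul_inv_self (1 : Q)
  rwa [one_mul] at h

theorem eq_mul_inv_of_mul_eq {x y z : Q} (h : x * y = z) : x = z * y⁻¹ := by
  rw [← h, mul_inv_cancel_right]

theorem left_moufang (x y z : Q) : ((x * y) * x) * z = x * (y * (x * z)) := by
  have := moufang x (y * (x * z)) (x * z)⁻¹
  rw [mul_inv_cancel_right, mul_inv_rev, inv_mul_cancel_right] at this
  rw [← this]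
  have h := mul_inv_cancel_right z⁻¹ (x * (y * (x * z)))
  rwa [inv_inv] at h

theorem left_alternative (x z : Q) : (x * x) * z = x * (x * z) := by
  simpa using left_moufang x 1 z

theorem flexible_inv (x y : Q) : x⁻¹ * (y * x) = (x⁻¹ * y) * x := by
  have h := flexible x (x⁻¹ * y)
  rw [mul_inv_cancel_left] at h
  rw [← left_cancel_iff (a := x), mul_inv_cancel_left, h]

theorem right_alternative (x y : Q) : (x * y) * y = x * (y * y) := by
  simpa using (congrArg (·⁻¹) (left_alternative y⁻¹ x⁻¹)).symm

/-- Conjugacy closure gives `L_x L_y L_x⁻¹ = L_c`; evaluating at `x` identifies `c`. -/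
theorem left_conjugation (x y z : Q) : x * (y * z) = ((x * y) * x⁻¹) * (x * z) := by
  obtain ⟨c, hc⟩ := hQ.out.1.1 x y
  have h (w : Q) : x * (y * w) = c * (x * w) := by
    have := congrArg (fun f : Equiv.Perm Q => f (x * w)) hc
    have e : (leftTranslation x)⁻¹ (x * w) = w := (leftTranslation x).symm_apply_apply w
    simpa [Equiv.Perm.mul_apply, e] using this.symm
  have h1 := h 1
  rw [mul_one, mul_one] at h1
  rw [h z, h1, mul_inv_cancel_right]

theorem extra (x y z : Q) : (x * y) * (x * z) = x * ((y * x) * z) := by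
  rw [left_conjugation x (y * x) z, flexible, mul_inv_cancel_right]

/-! ### Nuclear elements and conjugation. -/

/-- An element of a loop is nuclear if it associates with all pairs of elements, in every
position. -/
structure IsNuclear {Q : Type*} [Loop Q] (n : Q) : Prop where
  left : ∀ x y : Q, (n * x) * y = n * (x * y)
  middle : ∀ x y : Q, (x * n) * y = x * (n * y)
  right : ∀ x y : Q, (x * y) * n = x * (y * n)

/-- Inversion is an anti-automorphism, so with the inverse property the three nuclei coincide. -/
theorem isNuclear_of_left {n : Q} (h : ∀ x y : Q, (n * x) * y = n * (x * y)) : IsNuclear n := by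
  have hi (x y : Q) : (n⁻¹ * x) * y = n⁻¹ * (x * y) := by
    rw [← left_cancel_iff (a := n), ← h]; simp
  have hm (x y : Q) : (x * n⁻¹) * (n * y) = x * y := by
    have := h x⁻¹ (x * y)
    rw [inv_mul_cancel_left] at this
    rw [← this]
    have e := inv_mul_cancel_left (n * x⁻¹) (x * y)
    rwa [mul_inv_rev, inv_inv] at e
  refine ⟨h, fun x y => ?_, fun x y => ?_⟩
  · rw [← hm (x * n) y, mul_inv_cancel_right]
  · have := congrArg (·⁻¹) (hi y⁻¹ x⁻¹)
    simpa using this.symm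

theorem isNuclear_one : IsNuclear (1 : Q) := isNuclear_of_left (by simp)

/-- Substituting `x * y` and `x⁻¹ * w` in the extra law makes both sides collapse by the left
Moufang law. -/
theorem isNuclear_mul_self (x : Q) : IsNuclear (x * x) := by
  refine isNuclear_of_left fun y w => ?_
  have h := extra x (x * y) (x⁻¹ * w)
  rw [mul_inv_cancel_left, left_moufang, mul_inv_cancel_left] at h
  rw [left_alternative, left_alternative, h]

theorem IsNuclear.mul {m n : Q} (hm : IsNuclear m) (hn : IsNuclear n) : IsNuclear (m * n) :=
  isNuclear_of_left fun x y => by simp only [hm.left, hn.left]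

theorem IsNuclear.inv {n : Q} (hn : IsNuclear n) : IsNuclear n⁻¹ :=
  isNuclear_of_left fun x y => by
    rw [← left_cancel_iff (a := n), ← hn.left]; simp

/-- Conjugation `n ↦ x n x⁻¹`. -/
noncomputable def conj {Q : Type*} [Loop Q] (x n : Q) : Q := (x * n) * x⁻¹

theorem conj_mul_self (x n : Q) : conj x n * x = x * n := inv_mul_cancel_right _ _

theorem IsNuclear.conj {n : Q} (hn : IsNuclear n) (x : Q) : IsNuclear (conj x n) := by
  -- The right side has the form `c * w` with `c` independent of `w`; `w = 1` then identifies `c` as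
  -- `conj x n * y`.
  have key (y w : Q) : ExtraLoop.conj x n * (y * w) =
      ((x * (n * (x⁻¹ * (y * x)))) * x⁻¹) * w := by
    have h1 := left_conjugation x n (x⁻¹ * (y * w))
    rw [mul_inv_cancel_left] at h1
    rw [ExtraLoop.conj, ← h1]
    have h2 := left_conjugation x⁻¹ y w
    rw [inv_inv, ← flexible_inv] at h2
    rw [h2, ← hn.left, left_conjugation x, mul_inv_cancel_left]
  refine isNuclear_of_left fun y w => ?_
  have h := key y 1
  rw [mul_one, mul_one] at h
  rw [key, h]

theorem mul_nuclear_mul {n : Q} (hn : IsNuclear n) (x y : Q) :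
    x * (n * y) = conj x n * (x * y) := by
  rw [← (hn.conj x).left, conj_mul_self, hn.middle]

end ExtraLoop

namespace ExtraLoop

variable {Q : Type*} [Loop Q] [hQ : Fact (IsExtraLoop Q)]

theorem conj_mul {n m : Q} (hm : IsNuclear m) (x : Q) :
    conj x (n * m) = conj x n * conj x m := by
  rw [← right_cancel_iff (a := x), conj_mul_self, (hm.conj x).middle, conj_mul_self,
    ← hm.right, ← conj_mul_self x n, hm.right]

theorem conj_conj {n : Q} (hn : IsNuclear n) (x y : Q) :
    conj x (conj y n) = conj (x * y) n := by
  rw [← right_cancel_iff (a := x * y), conj_mul_self, ← ((hn.conj y).conj x).left, conj_mul_self,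
    (hn.conj y).middle, conj_mul_self, hn.right]

@[simp] theorem conj_one_right {Q : Type*} [Loop Q] (x : Q) : conj x 1 = 1 := by simp [conj]

@[simp] theorem conj_one_left {Q : Type*} [Loop Q] (n : Q) : conj 1 n = n := by simp [conj]

theorem conj_injective (x : Q) : Function.Injective (conj x) := by
  intro m n h
  have := congrArg (· * x) h
  simpa only [conj_mul_self, left_cancel_iff] using this

theorem nuclear_mul_eq {n : Q} (hn : IsNuclear n) (x : Q) : n * x = x * conj x⁻¹ n := by
  rw [← conj_mul_self x (conj x⁻¹ n), conj_conj hn, mul_inv_self, conj_one_left]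

/-! ### The congruence modulo the nucleus; its quotient is a group of exponent 2. -/

/-- Two elements are congruent modulo the nucleus. -/
def NuclearEq {Q : Type*} [Loop Q] (x y : Q) : Prop := ∃ n, IsNuclear n ∧ x = n * y

@[refl] theorem NuclearEq.refl (x : Q) : NuclearEq x x := ⟨1, isNuclear_one, (one_mul x).symm⟩

theorem NuclearEq.symm {x y : Q} (h : NuclearEq x y) : NuclearEq y x := by
  obtain ⟨n, hn, rfl⟩ := h
  exact ⟨n⁻¹, hn.inv, by simp⟩

theorem NuclearEq.trans {x y z : Q} (h : NuclearEq x y) (h' : NuclearEq y z) : NuclearEq x z := by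
  obtain ⟨n, hn, rfl⟩ := h
  obtain ⟨m, hm, rfl⟩ := h'
  exact ⟨n * m, hn.mul hm, (hn.left _ _).symm⟩

theorem NuclearEq.mul {x x' y y' : Q} (h : NuclearEq x x') (h' : NuclearEq y y') :
    NuclearEq (x * y) (x' * y') := by
  obtain ⟨n, hn, rfl⟩ := h
  obtain ⟨m, hm, rfl⟩ := h'
  exact ⟨n * conj x' m, hn.mul (hm.conj _), by rw [hn.left, mul_nuclear_mul hm, hn.left]⟩

theorem nuclearEq_inv (x : Q) : NuclearEq x⁻¹ x :=
  ⟨x⁻¹ * x⁻¹, isNuclear_mul_self _, by rw [left_alternative]; simp⟩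

theorem nuclearEq_mul_comm (x y : Q) : NuclearEq (x * y) (y * x) := by
  have h := (nuclearEq_inv (x * y)).symm
  rw [mul_inv_rev] at h
  exact h.trans ((nuclearEq_inv y).mul (nuclearEq_inv x))

theorem nuclearEq_mul_assoc (x y z : Q) : NuclearEq ((x * y) * z) (x * (y * z)) := by
  have key (a b c : Q) : NuclearEq (a * (b * c)) (b * (a * c)) := by
    rw [left_conjugation a b c]
    refine NuclearEq.mul ?_ (.refl _)
    have h := (nuclearEq_mul_comm a b).mul (.refl a⁻¹)
    rwa [mul_inv_cancel_right] at h
  refine (nuclearEq_mul_comm _ _).trans ((key z x y).trans ?_)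
  exact (NuclearEq.refl x).mul (nuclearEq_mul_comm z y)

/-! ### Associators: invariance modulo the nucleus, symmetry, order 2. -/

/-- The left-handed associator `a`, determined by `xy · z = a (x · yz)`. -/
noncomputable def asc {Q : Type*} [Loop Q] (x y z : Q) : Q := ((x * y) * z) * (x * (y * z))⁻¹

theorem asc_mul (x y z : Q) : asc x y z * (x * (y * z)) = (x * y) * z :=
  inv_mul_cancel_right _ _

theorem mul_mul_eq_asc_mul (x y z : Q) : (x * y) * z = asc x y z * (x * (y * z)) :=
  (asc_mul x y z).symm

theorem eq_asc {x y z n : Q} (h : n * (x * (y * z)) = (x * y) * z) : n = asc x y z :=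
  eq_mul_inv_of_mul_eq h

theorem isNuclear_asc (x y z : Q) : IsNuclear (asc x y z) := by
  obtain ⟨n, hn, h⟩ := nuclearEq_mul_assoc x y z
  rwa [← eq_asc h.symm]

theorem asc_mul_right {n : Q} (hn : IsNuclear n) (x y z : Q) : asc x y (z * n) = asc x y z := by
  refine (eq_asc ?_).symm
  rw [← hn.right, ← hn.right, ← hn.right, ← hn.right, asc_mul]

theorem asc_nuclear_mul_right {n : Q} (hn : IsNuclear n) (x y z : Q) :
    asc x y (n * z) = asc x y z := by
  rw [nuclear_mul_eq hn z, asc_mul_right (hn.conj _)]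

theorem asc_mul_middle {n : Q} (hn : IsNuclear n) (x y z : Q) :
    asc x (y * n) z = asc x y z := by
  rw [← asc_nuclear_mul_right hn x y z]
  refine eq_asc ?_
  rw [← hn.middle y z, asc_mul, ← hn.right, hn.middle]

theorem asc_nuclear_mul_middle {n : Q} (hn : IsNuclear n) (x y z : Q) :
    asc x (n * y) z = asc x y z := by
  rw [nuclear_mul_eq hn y, asc_mul_middle (hn.conj _)]

theorem asc_nuclear_mul_left {n : Q} (hn : IsNuclear n) (x y z : Q) :
    asc (n * x) y z = asc x y z := by
  have h := hn.conj x⁻¹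
  rw [nuclear_mul_eq hn x,
    ← asc_nuclear_mul_middle h x y z]
  refine eq_asc ?_
  rw [h.left, ← h.middle, asc_mul, h.middle]

theorem asc_congr {x x' y y' z z' : Q} (hx : NuclearEq x x') (hy : NuclearEq y y')
    (hz : NuclearEq z z') : asc x y z = asc x' y' z' := by
  obtain ⟨n, hn, rfl⟩ := hx
  obtain ⟨m, hm, rfl⟩ := hy
  obtain ⟨k, hk, rfl⟩ := hz
  rw [asc_nuclear_mul_left hn, asc_nuclear_mul_middle hm, asc_nuclear_mul_right hk]

/-- Compares the associators of `n * x, y, z` and `x, y, z`, which are equal. -/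
theorem asc_mul_comm_of_isNuclear {n : Q} (hn : IsNuclear n) (x y z : Q) :
    asc x y z * n = n * asc x y z := by
  have h : n * asc x y z * (x * (y * z)) = asc x y z * n * (x * (y * z)) := by
    rw [hn.left, asc_mul, hn.middle, ← hn.left x, ← asc_nuclear_mul_left hn x y z, asc_mul, hn.left,
      hn.left]
  exact (right_cancel_iff.1 h).symm

theorem conj_asc_of_isNuclear {n : Q} (hn : IsNuclear n) (x y z : Q) :
    conj n (asc x y z) = asc x y z := by
  rw [conj, ← asc_mul_comm_of_isNuclear hn, mul_inv_cancel_right]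

theorem conj_asc_congr {u v : Q} (h : NuclearEq u v) (x y z : Q) :
    conj u (asc x y z) = conj v (asc x y z) := by
  obtain ⟨n, hn, rfl⟩ := h
  rw [nuclear_mul_eq hn, ← conj_conj (isNuclear_asc x y z), conj_asc_of_isNuclear (hn.conj _)]

/-- The two ways of reassociating `((w * x) * y) * z` to `w * (x * (y * z))`. -/
theorem asc_cocycle (w x y z : Q) : asc (w * x) y z * asc w x (y * z) =
    asc w x y * (asc w (x * y) z * conj w (asc x y z)) := by
  rw [← right_cancel_iff (a := w * (x * (y * z))), (isNuclear_asc _ _ _).left, asc_mul, asc_mul,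
    (isNuclear_asc _ _ _).left, (isNuclear_asc _ _ _).left, ← mul_nuclear_mul (isNuclear_asc _ _ _),
    asc_mul, asc_mul, ← (isNuclear_asc _ _ _).left, asc_mul]

@[simp] theorem asc_self_left (x z : Q) : asc x x z = 1 :=
  (eq_asc (by rw [one_mul, left_alternative])).symm

theorem asc_mul_of_moufang (x y z : Q) : asc (x * y) x z * asc x y (x * z) = 1 := by
  rw [← right_cancel_iff (a := x * (y * (x * z))), (isNuclear_asc _ _ _).left, asc_mul, asc_mul,
    left_moufang, one_mul]

theorem asc_of_extra (x y z : Q) : asc x y (x * z) = conj x (asc y x z) := by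
  rw [← right_cancel_iff (a := x * (y * (x * z))), asc_mul, extra, mul_mul_eq_asc_mul y x z,
    mul_nuclear_mul (isNuclear_asc _ _ _)]

theorem asc_left_of_isNuclear {n : Q} (hn : IsNuclear n) (x y : Q) : asc n x y = 1 :=
  (eq_asc (by rw [one_mul, hn.left])).symm

theorem asc_middle_of_isNuclear {n : Q} (hn : IsNuclear n) (x y : Q) : asc x n y = 1 :=
  (eq_asc (by rw [one_mul, hn.middle])).symm

@[simp] theorem asc_self_right (x y : Q) : asc x y y = 1 :=
  (eq_asc (by rw [one_mul, right_alternative])).symm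

/-- The cocycle identity and the Moufang law give the same inverse to `asc y x (x * z)` and `asc x y
(x * z)`. The extra law then rewrites `asc x y z` as `asc y x z` conjugated twice by `x`, which is
trivial because `x * x` is nuclear. -/
theorem asc_swap_left (x y z : Q) : asc x y z = asc y x z := by
  have hsq : NuclearEq (x * (x * z)) z := ⟨x * x, isNuclear_mul_self x, (left_alternative x z).symm⟩
  have h1 : asc x y z = conj x (asc y x (x * z)) := by
    rw [← asc_of_extra, asc_congr (.refl x) (.refl y) hsq]
  have h2 : asc (y * x) x z * asc y x (x * z) = 1 := by
    rw [asc_cocycle, asc_self_right, asc_middle_of_isNuclear (isNuclear_mul_self x)]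
    simp
  have h3 : asc y x (x * z) = asc x y (x * z) := by
    rw [← left_cancel_iff (a := asc (y * x) x z), h2,
      asc_congr (nuclearEq_mul_comm y x) (.refl x) (.refl z), asc_mul_of_moufang]
  rw [h1, h3, asc_of_extra, conj_conj (isNuclear_asc _ _ _),
    conj_asc_of_isNuclear (isNuclear_mul_self x)]

/-- Inverting `xy · z = a (x · yz)` reverses the arguments and moves `a` to the right; the inverses
disappear modulo the nucleus. -/
theorem asc_reverse (x y z : Q) : asc z y x = conj (z * (y * x)) (asc x y z) := by
  have e : conj (z⁻¹ * (y⁻¹ * x⁻¹)) (asc x y z) = conj (z * (y * x)) (asc x y z) :=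
    conj_asc_congr ((nuclearEq_inv z).mul ((nuclearEq_inv y).mul (nuclearEq_inv x))) _ _ _
  rw [← e, ← asc_congr (nuclearEq_inv z) (nuclearEq_inv y) (nuclearEq_inv x)]
  refine (eq_asc ?_).symm
  have h := congrArg (·⁻¹) (mul_mul_eq_asc_mul x y z)
  simp only [mul_inv_rev] at h
  rw [conj_mul_self, h]
  simp

theorem asc_swap_right (x y z : Q) : asc x y z = asc x z y := by
  have h : NuclearEq (x * (y * z)) (x * (z * y)) := (NuclearEq.refl x).mul (nuclearEq_mul_comm y z)
  have h' : NuclearEq (x * (y * z)) (x * (y * z)) := .refl _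
  rw [asc_reverse z y x, conj_asc_congr h, asc_swap_left z y x, ← asc_reverse]

/-- The cocycle identity at `w = x` reduces to `conj x` of the square being trivial. -/
theorem asc_mul_self (x y z : Q) : asc x y z * asc x y z = 1 := by
  have h := asc_cocycle x x y z
  rw [asc_left_of_isNuclear (isNuclear_mul_self x), asc_self_left, asc_self_left, one_mul, one_mul,
    asc_swap_right x (x * y), asc_of_extra, asc_swap_left z, asc_swap_right x z,
    ← conj_mul (isNuclear_asc x y z)] at h
  apply conj_injective x
  rw [← h, conj_one_right]

theorem conj_asc_self (x y z : Q) : conj (x * (y * z)) (asc x y z) = asc x y z := by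
  have e : asc z y x = asc x y z := by
    rw [asc_swap_left z, asc_swap_right y, asc_swap_left y]
  rw [← e, ← asc_reverse, e]

/-- The associator `c` with `(x · yz) c = xy · z` agrees with the left-handed one. -/
theorem mul_asc (x y z : Q) : (x * (y * z)) * asc x y z = (x * y) * z := by
  rw [← conj_mul_self, conj_asc_self, asc_mul]

end ExtraLoop

/-! ### The associator subloop `A` and the products `A P`. -/

namespace Subloop

variable {Q : Type*} [Loop Q]

theorem one_mem (S : Subloop Q) : (1 : Q) ∈ S := S.one_mem'

theorem mul_mem (S : Subloop Q) {a b : Q} (ha : a ∈ S) (hb : b ∈ S) : a * b ∈ S :=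
  S.mul_mem' ha hb

theorem mem_of_mul_mem_left (S : Subloop Q) {a b : Q} (ha : a ∈ S) (h : a * b ∈ S) : b ∈ S :=
  S.mem_of_mul_mem_left' ha h

theorem mem_of_mul_mem_right (S : Subloop Q) {a b : Q} (hb : b ∈ S) (h : a * b ∈ S) : a ∈ S :=
  S.mem_of_mul_mem_right' hb h

theorem inv_mem (S : Subloop Q) {a : Q} (ha : a ∈ S) : a⁻¹ ∈ S :=
  S.mem_of_mul_mem_left ha (by rw [mul_inv_self]; exact S.one_mem)

theorem subset_closure (X : Set Q) : X ⊆ closure X := fun _ hx _ hS => hS hx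

theorem closure_le {X : Set Q} {S : Subloop Q} (h : X ⊆ S) : closure X ≤ S := fun _ hx => hx S h

end Subloop

namespace ExtraLoop

variable {Q : Type*} [Loop Q] [hQ : Fact (IsExtraLoop Q)]

/-- A subset closed under multiplication and inversion is a subloop. -/
def subloopOfInvMem (X : Set Q) (h1 : (1 : Q) ∈ X) (hmul : ∀ a ∈ X, ∀ b ∈ X, a * b ∈ X)
    (hinv : ∀ a ∈ X, a⁻¹ ∈ X) : Subloop Q where
  carrier := X
  one_mem' := h1
  mul_mem' ha hb := hmul _ ha _ hb
  mem_of_mul_mem_left' {a b} ha hab := by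
    simpa using hmul _ (hinv _ ha) _ hab
  mem_of_mul_mem_right' {a b} hb hab := by
    simpa using hmul _ hab _ (hinv _ hb)

/-- Nuclear elements that commute with the nucleus and have square `1`. -/
structure IsNuclearCentralInvolutive {Q : Type*} [Loop Q] (a : Q) : Prop where
  isNuclear : IsNuclear a
  comm : ∀ n : Q, IsNuclear n → a * n = n * a
  mul_self : a * a = 1

theorem IsNuclearCentralInvolutive.inv_eq {Q : Type*} [Loop Q] {a : Q}
    (h : IsNuclearCentralInvolutive a) : a⁻¹ = a := by
  rw [← left_cancel_iff (a := a), mul_inv_self, h.mul_self]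

theorem IsNuclearCentralInvolutive.mul {a b : Q} (ha : IsNuclearCentralInvolutive a)
    (hb : IsNuclearCentralInvolutive b) : IsNuclearCentralInvolutive (a * b) where
  isNuclear := ha.isNuclear.mul hb.isNuclear
  comm n hn := by rw [ha.isNuclear.left, hb.comm n hn, ← ha.isNuclear.left, ha.comm n hn, hn.left]
  mul_self := by
    rw [ha.isNuclear.left, ← hb.isNuclear.left, hb.comm a ha.isNuclear, ha.isNuclear.left,
      hb.mul_self, mul_one, ha.mul_self]

theorem asc_mem (x y z : Q) : asc x y z ∈ associatorSubloop Q :=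
  Subloop.subset_closure _ ⟨x, y, z, mul_asc x y z⟩

theorem associatorSubloop_le {S : Subloop Q} (h : ∀ x y z : Q, asc x y z ∈ S) :
    associatorSubloop Q ≤ S := by
  refine Subloop.closure_le ?_
  rintro c ⟨x, y, z, hc⟩
  rw [← mul_asc x y z, left_cancel_iff] at hc
  exact hc ▸ h x y z

theorem isNuclearCentralInvolutive_of_mem {a : Q} (ha : a ∈ associatorSubloop Q) :
    IsNuclearCentralInvolutive a := by
  let S : Subloop Q := subloopOfInvMem {a | IsNuclearCentralInvolutive a}
    ⟨isNuclear_one, by simp, by simp⟩ (fun a ha b hb => ha.mul hb)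
    (fun a ha => by rwa [Set.mem_ofPred, IsNuclearCentralInvolutive.inv_eq ha])
  exact associatorSubloop_le (S := S) (fun x y z => ⟨isNuclear_asc x y z,
    fun n hn => asc_mul_comm_of_isNuclear hn x y z, asc_mul_self x y z⟩) ha

theorem isNuclear_of_mem {a : Q} (ha : a ∈ associatorSubloop Q) : IsNuclear a :=
  (isNuclearCentralInvolutive_of_mem ha).isNuclear

theorem conj_mem {a : Q} (ha : a ∈ associatorSubloop Q) (w : Q) :
    conj w a ∈ associatorSubloop Q := by
  let S : Subloop Q := subloopOfInvMem {a | a ∈ associatorSubloop Q ∧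
      conj w a ∈ associatorSubloop Q}
    ⟨Subloop.one_mem _, by rw [conj_one_right]; exact Subloop.one_mem _⟩
    (fun a ha b hb => ⟨Subloop.mul_mem _ ha.1 hb.1, by
      rw [conj_mul (isNuclear_of_mem hb.1)]
      exact Subloop.mul_mem _ ha.2 hb.2⟩)
    (fun a ha => by
      rwa [Set.mem_ofPred, (isNuclearCentralInvolutive_of_mem ha.1).inv_eq])
  refine (associatorSubloop_le (S := S) (fun x y z => ⟨asc_mem x y z, ?_⟩) ha).2
  -- All other factors of the cocycle identity are associators, so the conjugated one lies in `A`.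
  have h := asc_cocycle w x y z
  refine Subloop.mem_of_mul_mem_left _ (asc_mem w (x * y) z) ?_
  refine Subloop.mem_of_mul_mem_left _ (asc_mem w x y) ?_
  rw [← h]
  exact Subloop.mul_mem _ (asc_mem _ _ _) (asc_mem _ _ _)

/-- The subloop `A P` generated by the associator subloop and a subloop `P`. -/
def associatorMul (P : Subloop Q) : Subloop Q where
  carrier := {x | ∃ a ∈ associatorSubloop Q, a * x ∈ P}
  one_mem' := ⟨1, Subloop.one_mem _, by rw [one_mul]; exact P.one_mem⟩
  mul_mem' := by
    rintro x y ⟨a, ha, hx⟩ ⟨b, hb, hy⟩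
    refine ⟨a * conj x b, Subloop.mul_mem _ ha (conj_mem hb x), ?_⟩
    rw [(isNuclear_of_mem ha).left, ← mul_nuclear_mul (isNuclear_of_mem hb),
      ← (isNuclear_of_mem ha).left]
    exact P.mul_mem hx hy
  mem_of_mul_mem_left' := by
    rintro x y ⟨a, ha, hx⟩ ⟨b, hb, hxy⟩
    have hd : conj x⁻¹ (a⁻¹ * b) ∈ associatorSubloop Q :=
      conj_mem (Subloop.mul_mem _ (Subloop.inv_mem _ ha) hb) _
    refine ⟨_, hd, P.mem_of_mul_mem_left hx ?_⟩
    have hab := (isNuclear_of_mem ha).inv.mul (isNuclear_of_mem hb)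
    rwa [(isNuclear_of_mem ha).left, mul_nuclear_mul (isNuclear_of_mem hd), conj_conj hab,
      mul_inv_self, conj_one_left, ← (isNuclear_of_mem ha).left, mul_inv_cancel_left]
  mem_of_mul_mem_right' := by
    rintro x y ⟨b, hb, hy⟩ ⟨d, hd, hxy⟩
    have he : d * (conj x b)⁻¹ ∈ associatorSubloop Q :=
      Subloop.mul_mem _ hd (Subloop.inv_mem _ (conj_mem hb x))
    refine ⟨_, he, P.mem_of_mul_mem_right hy ?_⟩
    rwa [(isNuclear_of_mem he).left, mul_nuclear_mul (isNuclear_of_mem hb),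
      ← (isNuclear_of_mem he).left, inv_mul_cancel_right]

theorem le_associatorMul (P : Subloop Q) : P ≤ associatorMul P := fun x hx =>
  ⟨1, Subloop.one_mem _, by rwa [one_mul]⟩

theorem associatorSubloop_le_associatorMul (P : Subloop Q) :
    associatorSubloop Q ≤ associatorMul P := fun a ha =>
  ⟨a⁻¹, Subloop.inv_mem _ ha, by rw [inv_mul_self]; exact P.one_mem⟩

/-- The product map `A × P → A P` has all fibres in bijection with `A ∩ P`: if `a * y ∈ P`, a pair
`(b, x)` over `y` corresponds to `a * b`. -/
theorem card_associatorMul [Finite Q] (P : Subloop Q) :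
    Nat.card (associatorSubloop Q) * Nat.card P = Nat.card (associatorMul P) *
      Nat.card {x : Q // x ∈ associatorSubloop Q ∧ x ∈ P} := by
  classical
  let f : associatorSubloop Q × P → associatorMul P := fun u => ⟨u.1 * u.2,
    Subloop.mul_mem _ (associatorSubloop_le_associatorMul P u.1.2) (le_associatorMul P u.2.2)⟩
  have key (y : associatorMul P) : Nat.card {u // f u = y} =
      Nat.card {x : Q // x ∈ associatorSubloop Q ∧ x ∈ P} := by
    obtain ⟨y, a, ha, hy⟩ := y
    have hN := isNuclear_of_mem ha
    refine Nat.card_congr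
      { toFun u := ⟨a * u.1.1, Subloop.mul_mem _ ha u.1.1.2,
          P.mem_of_mul_mem_right u.1.2.2 ?_⟩
        invFun d := ⟨(⟨a⁻¹ * d, Subloop.mul_mem _ (Subloop.inv_mem _ ha) d.2.1⟩,
          ⟨(d : Q)⁻¹ * (a * y), P.mul_mem (P.inv_mem d.2.2) hy⟩), ?_⟩
        left_inv u := ?_
        right_inv d := ?_ }
    · have := congrArg Subtype.val u.2
      rw [hN.left]
      change a * ((f u.1 : _) : Q) ∈ P
      rw [this]
      exact hy
    · refine Subtype.ext ?_
      change (a⁻¹ * (d : Q)) * ((d : Q)⁻¹ * (a * y)) = y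
      rw [hN.inv.left]
      simp
    · obtain ⟨⟨⟨b, hb⟩, x, hx⟩, h⟩ := u
      have h' : b * x = y := congrArg Subtype.val h
      ext
      · simp
      · simp only [← h', ← hN.left]
        exact inv_mul_cancel_left (a * b) x
    · simp
  have := Fintype.ofFinite (associatorMul P)
  rw [← Nat.card_prod, ← Nat.card_congr (Equiv.sigmaFiberEquiv f), Nat.card_sigma]
  simp_rw [key]
  rw [Finset.sum_const, Finset.card_univ, smul_eq_mul, Fintype.card_eq_nat_card]

end ExtraLoop

/-! ### The right multiplication group and evaluation at `1`. -/

namespace ExtraLoop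

variable {Q : Type*} [Loop Q]

/-- The right translation by `a`, as an element of the right multiplication group. -/
noncomputable def rTrans (a : Q) : RMlt Q :=
  ⟨rightTranslation a, Subgroup.subset_closure ⟨a, rfl⟩⟩

@[simp] theorem rTrans_apply (a x : Q) : (rTrans a : Equiv.Perm Q) x = x * a := rfl

theorem rTrans_injective : Function.Injective (rTrans : Q → RMlt Q) := fun a b h => by
  simpa using congrArg (fun g : RMlt Q => (g : Equiv.Perm Q) 1) h

theorem mem_RMltOne {g : RMlt Q} : g ∈ RMltOne Q ↔ (g : Equiv.Perm Q) 1 = 1 := Iff.rfl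

theorem mem_rightTranslationSet {S : Set Q} {g : RMlt Q} :
    g ∈ rightTranslationSet S ↔ ∃ a ∈ S, g = rTrans a := by
  simp only [rightTranslationSet, Subtype.ext_iff]; rfl

theorem inv_apply_eq {g : RMlt Q} {x y : Q} :
    ((g⁻¹ : RMlt Q) : Equiv.Perm Q) x = y ↔ x = (g : Equiv.Perm Q) y := by
  rw [Subgroup.coe_inv]; exact Equiv.Perm.inv_eq_iff_eq

theorem rTrans_inv_mul_mem (g : RMlt Q) :
    (rTrans ((g : Equiv.Perm Q) 1))⁻¹ * g ∈ RMltOne Q := by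
  rw [mem_RMltOne, Subgroup.coe_mul, Equiv.Perm.mul_apply, inv_apply_eq, rTrans_apply, one_mul]

/-- Every `g` factors as `R_{g 1}` after an element fixing `1`, so `RMlt₁ · R(S)` is the preimage of
`S` under evaluation at `1`. -/
theorem mem_innerMulRightTranslationSet {S : Set Q} {g : RMlt Q} :
    g ∈ innerMulRightTranslationSet S ↔ (g : Equiv.Perm Q) 1 ∈ S := by
  constructor
  · rintro ⟨h, hh, a, ha, e⟩
    rw [e, Equiv.Perm.mul_apply, mem_RMltOne.1 hh, rightTranslation_apply, one_mul]
    exact ha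
  · intro h
    refine ⟨_, rTrans_inv_mul_mem g, _, h, ?_⟩
    change _ = ((rTrans _ : RMlt Q) : Equiv.Perm Q) * _
    rw [← Subgroup.coe_mul, _root_.mul_inv_cancel_left]

theorem card_innerMulRightTranslationSet (S : Set Q) :
    Nat.card (innerMulRightTranslationSet S) = Nat.card (RMltOne Q) * Nat.card S := by
  rw [← Nat.card_prod]
  exact Nat.card_congr
    { toFun g := (⟨_, rTrans_inv_mul_mem g.1⟩, ⟨_, mem_innerMulRightTranslationSet.1 g.2⟩)
      invFun u := ⟨rTrans (u.2 : Q) * u.1, mem_innerMulRightTranslationSet.2 (by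
        rw [Subgroup.coe_mul, Equiv.Perm.mul_apply, mem_RMltOne.1 u.1.2, rTrans_apply, one_mul]
        exact u.2.2)⟩
      left_inv g := by simp
      right_inv u := by
        obtain ⟨⟨h, hh⟩, a, ha⟩ := u
        have : (h : Equiv.Perm Q) 1 = 1 := hh
        simp [this] }

theorem card_RMlt : Nat.card (RMlt Q) = Nat.card (RMltOne Q) * Nat.card Q := by
  have h := card_innerMulRightTranslationSet (Set.univ : Set Q)
  rw [show innerMulRightTranslationSet (Set.univ : Set Q) = Set.univ from
    Set.eq_univ_of_forall fun g => mem_innerMulRightTranslationSet.2 trivial] at h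
  simpa using h

theorem card_rightTranslationSet (S : Set Q) :
    Nat.card (rightTranslationSet S) = Nat.card S := by
  rw [show rightTranslationSet S = rTrans '' S from
    Set.ext fun g => by rw [mem_rightTranslationSet]; simp [eq_comm]]
  exact Nat.card_image_of_injective rTrans_injective S

/-- Left translations by nuclear elements commute with all right translations. -/
theorem map_nuclear_mul (g : RMlt Q) {n : Q} (hn : IsNuclear n) (x : Q) :
    (g : Equiv.Perm Q) (n * x) = n * (g : Equiv.Perm Q) x := by
  obtain ⟨g, hg⟩ := g
  change g (n * x) = n * g x
  induction hg using Subgroup.closure_induction generalizing x with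
  | mem g hg => obtain ⟨a, rfl⟩ := hg; exact hn.left x a
  | one => rfl
  | mul f g _ _ hf hg => rw [Equiv.Perm.mul_apply, hg, hf]; rfl
  | inv g _ hg =>
    rw [Equiv.Perm.inv_eq_iff_eq, hg]; simp

theorem rTrans_mul_rTrans_of_isNuclear {a b : Q} (hb : IsNuclear b) :
    rTrans b * rTrans a = rTrans (a * b) := by
  ext x
  exact hb.right x a

theorem rightTranslationSet_injective :
    Function.Injective (rightTranslationSet : Set Q → Set (RMlt Q)) := by
  intro S T h
  ext x
  have key (S : Set Q) : x ∈ S ↔ rTrans x ∈ rightTranslationSet S := by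
    rw [mem_rightTranslationSet]
    exact ⟨fun hx => ⟨x, hx, rfl⟩, fun ⟨y, hy, e⟩ => rTrans_injective e ▸ hy⟩
  rw [key, h, ← key]

theorem innerMulRightTranslationSet_injective :
    Function.Injective (innerMulRightTranslationSet : Set Q → Set (RMlt Q)) := by
  intro S T h
  ext x
  have key (S : Set Q) : x ∈ S ↔ rTrans x ∈ innerMulRightTranslationSet S := by
    rw [mem_innerMulRightTranslationSet, rTrans_apply, one_mul]
  rw [key, h, ← key]

variable [hQ : Fact (IsExtraLoop Q)]

theorem map_mul (g : RMlt Q) (x y : Q) :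
    ∃ a ∈ associatorSubloop Q, (g : Equiv.Perm Q) (x * y) = a * (x * (g : Equiv.Perm Q) y) := by
  obtain ⟨g, hg⟩ := g
  change ∃ a ∈ associatorSubloop Q, g (x * y) = a * (x * g y)
  induction hg using Subgroup.closure_induction generalizing x y with
  | mem g hg => obtain ⟨z, rfl⟩ := hg; exact ⟨_, asc_mem x y z, (asc_mul x y z).symm⟩
  | one => exact ⟨1, Subloop.one_mem _, by simp⟩
  | mul f g hf' _ hf hg =>
    obtain ⟨a, ha, h⟩ := hg x y
    obtain ⟨b, hb, h'⟩ := hf x (g y)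
    refine ⟨a * b, Subloop.mul_mem _ ha hb, ?_⟩
    have := map_nuclear_mul ⟨f, hf'⟩ (isNuclear_of_mem ha) (x * g y)
    dsimp only at this
    rw [Equiv.Perm.mul_apply, h, this, h', (isNuclear_of_mem ha).left]; rfl
  | inv g hg' hg =>
    obtain ⟨a, ha, h⟩ := hg x (g⁻¹ y)
    refine ⟨a⁻¹, Subloop.inv_mem _ ha, ?_⟩
    have := map_nuclear_mul ⟨g, hg'⟩ (isNuclear_of_mem ha).inv (x * g⁻¹ y)
    dsimp only at this
    rw [Equiv.Perm.inv_eq_iff_eq, this, h]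
    simp

theorem map_eq (g : RMlt Q) (x : Q) : ∃ a ∈ associatorSubloop Q,
    (g : Equiv.Perm Q) x = a * (x * (g : Equiv.Perm Q) 1) := by
  simpa using map_mul g x 1

theorem isNuclear_map {g : RMlt Q} {x : Q} (hx : IsNuclear x)
    (hg : IsNuclear ((g : Equiv.Perm Q) 1)) : IsNuclear ((g : Equiv.Perm Q) x) := by
  obtain ⟨a, ha, h⟩ := map_eq g x
  rw [h]
  exact (isNuclear_of_mem ha).mul (hx.mul hg)

/-- Such an `h` acts on each `x` by some `a ∈ A`, and `a * a = 1`. -/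
theorem mul_self_of_mem_RMltOne {h : RMlt Q} (hh : h ∈ RMltOne Q) : h * h = 1 := by
  ext x
  obtain ⟨a, ha, e⟩ := map_eq h x
  rw [mem_RMltOne.1 hh, mul_one] at e
  rw [Subgroup.coe_mul, Equiv.Perm.mul_apply, e, map_nuclear_mul h (isNuclear_of_mem ha), e,
    ← (isNuclear_of_mem ha).left, (isNuclearCentralInvolutive_of_mem ha).mul_self, one_mul]
  rfl

end ExtraLoop

/-! ### Passing between subloops of `Q` and subgroups of `RMlt Q`. -/

namespace ExtraLoop

variable {Q : Type*} [Loop Q] [hQ : Fact (IsExtraLoop Q)]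

theorem rTrans_inv (a : Q) : rTrans a⁻¹ = (rTrans a)⁻¹ := by
  rw [eq_inv_iff_mul_eq_one]
  ext x
  simp

theorem mem_associatorStar {g : RMlt Q} :
    g ∈ associatorStar Q ↔ (g : Equiv.Perm Q) 1 ∈ associatorSubloop Q := by
  constructor
  · intro h
    obtain ⟨a, ha, e⟩ := h 1
    rwa [e, mul_one]
  · intro h x
    obtain ⟨a, ha, e⟩ := map_eq g x
    refine ⟨a * conj x ((g : Equiv.Perm Q) 1), Subloop.mul_mem _ ha (conj_mem h x), ?_⟩
    rw [e, (isNuclear_of_mem ha).left, conj_mul_self]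

/-- For a subloop `P` containing `A(Q)`, the subgroup of all `g` with `g 1 ∈ P`. -/
def fiberSubgroup (P : Subloop Q) (hP : associatorSubloop Q ≤ P) : Subgroup (RMlt Q) where
  carrier := innerMulRightTranslationSet P
  one_mem' := mem_innerMulRightTranslationSet.2 P.one_mem
  mul_mem' {f g} hf hg := by
    rw [mem_innerMulRightTranslationSet, SetLike.mem_coe] at *
    obtain ⟨a, ha, e⟩ := map_eq f ((g : Equiv.Perm Q) 1)
    rw [Subgroup.coe_mul, Equiv.Perm.mul_apply, e]
    exact P.mul_mem (hP ha) (P.mul_mem hg hf)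
  inv_mem' {g} hg := by
    rw [mem_innerMulRightTranslationSet, SetLike.mem_coe] at *
    obtain ⟨a, ha, e⟩ := map_eq g (((g⁻¹ : RMlt Q) : Equiv.Perm Q) 1)
    rw [← inv_apply_eq.1 rfl] at e
    refine P.mem_of_mul_mem_right hg (P.mem_of_mul_mem_left (hP ha) ?_)
    rw [← e]
    exact P.one_mem

theorem mem_fiberSubgroup {P : Subloop Q} {hP : associatorSubloop Q ≤ P} {g : RMlt Q} :
    g ∈ fiberSubgroup P hP ↔ (g : Equiv.Perm Q) 1 ∈ P := mem_innerMulRightTranslationSet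

/-- The subgroup `A*` of the right multiplication group. -/
def associatorStarSubgroup (Q : Type*) [Loop Q] [Fact (IsExtraLoop Q)] : Subgroup (RMlt Q) :=
  fiberSubgroup (associatorSubloop Q) le_rfl

theorem coe_associatorStarSubgroup :
    (associatorStarSubgroup Q : Set (RMlt Q)) = associatorStar Q := by
  ext g
  rw [mem_associatorStar]
  exact mem_fiberSubgroup

theorem RMltOne_le_associatorStarSubgroup : RMltOne Q ≤ associatorStarSubgroup Q := fun g hg => by
  refine mem_fiberSubgroup.2 ?_
  rw [mem_RMltOne.1 hg]
  exact Subloop.one_mem _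

instance normal_associatorStarSubgroup : (associatorStarSubgroup Q).Normal where
  conj_mem g hg k := by
    rw [← SetLike.mem_coe, coe_associatorStarSubgroup] at hg ⊢
    intro x
    obtain ⟨a, ha, e⟩ := hg (((k⁻¹ : RMlt Q) : Equiv.Perm Q) x)
    refine ⟨a, ha, ?_⟩
    rw [Subgroup.coe_mul, Equiv.Perm.mul_apply, Subgroup.coe_mul, Equiv.Perm.mul_apply, e,
      map_nuclear_mul k (isNuclear_of_mem ha), ← inv_apply_eq.1 rfl]

theorem commute_rTrans_of_mem_RMltOne {h : RMlt Q} (hh : h ∈ RMltOne Q) {n : Q}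
    (hn : IsNuclear n) : Commute h (rTrans n) := by
  ext x
  obtain ⟨a, ha, e⟩ := map_eq h x
  rw [mem_RMltOne.1 hh, mul_one] at e
  change (h : Equiv.Perm Q) (x * n) = (h : Equiv.Perm Q) x * n
  have hc := hn.conj x
  rw [← conj_mul_self, map_nuclear_mul h hc, e, (isNuclear_of_mem ha).left, ← conj_mul_self x n,
    ← hc.left, ← (isNuclear_of_mem ha).left, (isNuclearCentralInvolutive_of_mem ha).comm _ hc]

theorem mul_self_of_isNuclear_map {g : RMlt Q} (hg : IsNuclear ((g : Equiv.Perm Q) 1)) :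
    g * g = rTrans ((g : Equiv.Perm Q) 1) * rTrans ((g : Equiv.Perm Q) 1) := by
  have hh := rTrans_inv_mul_mem g
  have hc := commute_rTrans_of_mem_RMltOne hh hg
  have h2 := mul_self_of_mem_RMltOne hh
  clear hh hg
  generalize rTrans ((g : Equiv.Perm Q) 1) = r at *
  obtain ⟨h, rfl⟩ : ∃ h, g = r * h := ⟨r⁻¹ * g, by simp⟩
  rw [_root_.inv_mul_cancel_left] at hc h2
  rw [hc.mul_mul_mul_comm, h2, mul_one]

theorem isPGroup_associatorStarSubgroup : IsPGroup 2 (associatorStarSubgroup Q) := by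
  rintro ⟨g, hg⟩
  refine ⟨1, Subtype.ext ?_⟩
  have ha : (g : Equiv.Perm Q) 1 ∈ associatorSubloop Q := mem_fiberSubgroup.1 hg
  have hc := isNuclearCentralInvolutive_of_mem ha
  change g ^ (2 ^ 1) = 1
  rw [pow_one, pow_two, mul_self_of_isNuclear_map hc.isNuclear,
    rTrans_mul_rTrans_of_isNuclear hc.isNuclear, hc.mul_self]
  ext x
  simp

theorem associatorStar_subset_sylow (K : Sylow 2 (RMlt Q)) :
    associatorStar Q ⊆ (K : Set (RMlt Q)) := by
  rw [← coe_associatorStarSubgroup]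
  exact isPGroup_associatorStarSubgroup.le_sylow_of_normal K

/-- A subgroup of the right multiplication group gives a subloop if its right translations are
closed under loop multiplication. -/
def subloopOfSubgroup (K : Subgroup (RMlt Q))
    (hK : ∀ a b : Q, rTrans a ∈ K → rTrans b ∈ K → rTrans (a * b) ∈ K) : Subloop Q :=
  subloopOfInvMem {x | rTrans x ∈ K}
    (by rw [Set.mem_ofPred, show rTrans (1 : Q) = 1 by ext; simp]; exact K.one_mem)
    (fun a ha b hb => hK a b ha hb)
    (fun a ha => by rw [Set.mem_ofPred, rTrans_inv]; exact K.inv_mem ha)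

theorem exists_subloop_of_associatorStar_subset (K : Subgroup (RMlt Q))
    (hK : associatorStar Q ⊆ K) : ∃ P : Subloop Q, associatorSubloop Q ≤ P ∧
      innerMulRightTranslationSet (P : Set Q) = K := by
  have hH : RMltOne Q ≤ K := RMltOne_le_associatorStarSubgroup.trans
    (by rwa [← SetLike.coe_subset_coe, coe_associatorStarSubgroup])
  -- As `K` contains `RMlt₁`, membership in `K` depends only on `g 1`.
  have key (g : RMlt Q) : rTrans ((g : Equiv.Perm Q) 1) ∈ K ↔ g ∈ K := by
    rw [← K.mul_mem_cancel_right (hH (rTrans_inv_mul_mem g)), _root_.mul_inv_cancel_left]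
  refine ⟨subloopOfSubgroup K fun a b ha hb => ?_, fun a ha => ?_, ?_⟩
  · have := (key _).2 (K.mul_mem hb ha)
    simpa using this
  · refine hK (mem_associatorStar.2 ?_)
    rwa [rTrans_apply, one_mul]
  · ext g
    rw [mem_innerMulRightTranslationSet]
    exact key g

/-- The nucleus of an extra loop. -/
def nucleus (Q : Type*) [Loop Q] [Fact (IsExtraLoop Q)] : Subloop Q :=
  subloopOfInvMem {x | IsNuclear x} isNuclear_one (fun _ ha _ hb => ha.mul hb) (fun _ ha => ha.inv)

/-- The subgroup `R(S)` for a subloop `S` of the nucleus. -/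
def translationSubgroup (S : Subloop Q) (hS : ∀ x ∈ S, IsNuclear x) : Subgroup (RMlt Q) where
  carrier := rightTranslationSet S
  one_mem' := mem_rightTranslationSet.2 ⟨1, S.one_mem, by ext; simp⟩
  mul_mem' {f g} hf hg := by
    rw [mem_rightTranslationSet] at *
    obtain ⟨a, ha, rfl⟩ := hf
    obtain ⟨b, hb, rfl⟩ := hg
    exact ⟨_, S.mul_mem hb ha, rTrans_mul_rTrans_of_isNuclear (hS a ha)⟩
  inv_mem' {f} hf := by
    rw [mem_rightTranslationSet] at *
    obtain ⟨a, ha, rfl⟩ := hf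
    exact ⟨_, S.inv_mem ha, (rTrans_inv a).symm⟩

theorem isNuclear_of_odd_card [Finite Q] {S : Subloop Q} (hS : Odd (Nat.card S)) {x : Q}
    (hx : x ∈ S) : IsNuclear x := by
  classical
  let f : Equiv.Perm S :=
    { toFun s := ⟨x * s, S.mul_mem hx s.2⟩
      invFun s := ⟨x⁻¹ * s, S.mul_mem (S.inv_mem hx) s.2⟩
      left_inv s := by simp
      right_inv s := by simp }
  -- `f` is left multiplication by `x`, so its even powers multiply by nuclear elements.
  have hsq (t : ℕ) : ∃ m : Q, IsNuclear m ∧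
      ∀ s : S, (((f ^ 2) ^ t) s : Q) = m * s := by
    induction t with
    | zero => exact ⟨1, isNuclear_one, fun s => by simp⟩
    | succ t ih =>
      obtain ⟨m, hm, h⟩ := ih
      refine ⟨x * x * m, (isNuclear_mul_self x).mul hm, fun s => ?_⟩
      rw [pow_succ', Equiv.Perm.mul_apply, pow_two, (isNuclear_mul_self x).left, ← h,
        left_alternative]
      rfl
  obtain ⟨j, m, hm, he⟩ := Nat.exists_eq_two_pow_mul_odd (orderOf_pos f).ne'
  have hp : (f ^ m) ^ 2 ^ j = 1 := by rw [← pow_mul, mul_comm, ← he, pow_orderOf_eq_one]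
  have := Fintype.ofFinite S
  have hdvd : ¬ 2 ∣ Fintype.card S := by
    rwa [Fintype.card_eq_nat_card, ← even_iff_two_dvd, Nat.not_even_iff_odd]
  -- `f ^ m`, with `m` the odd part of the order, has 2-power order on a set of odd size, so it
  -- fixes a point. Cancelling that point yields `x * n = 1` with `n` nuclear.
  obtain ⟨s, hs⟩ := Equiv.Perm.exists_fixed_point_of_prime hdvd hp
  obtain ⟨t, rfl⟩ := hm
  obtain ⟨n, hn, h⟩ := hsq t
  rw [pow_succ', pow_mul, Equiv.Perm.mul_apply] at hs
  have hs' : x * (n * s) = 1 * (s : Q) := by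
    rw [← h, one_mul]
    exact congrArg Subtype.val hs
  rw [← hn.middle, right_cancel_iff] at hs'
  rw [eq_mul_inv_of_mul_eq hs', one_mul]
  exact hn.inv

theorem exists_eq_rTrans_of_odd [Finite Q] {K : Subgroup (RMlt Q)} (hK : Odd (Nat.card K))
    {g : RMlt Q} (hg : g ∈ K) : ∃ n : Q, IsNuclear n ∧ g = rTrans n := by
  obtain ⟨t, ht⟩ := hK
  have h1 : g ^ (2 * t + 1) = 1 := by
    rw [← ht]
    exact congrArg Subtype.val (pow_card_eq_one' (x := (⟨g, hg⟩ : K)))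
  -- `g² 1` is a square times an element of `A`; then `g ^ (2 * t + 1) = 1` exhibits `g 1` as the
  -- inverse of the nuclear `(g²) ^ t 1`.
  have h2 : IsNuclear (((g * g : RMlt Q) : Equiv.Perm Q) 1) := by
    obtain ⟨a, ha, e⟩ := map_eq g ((g : Equiv.Perm Q) 1)
    rw [Subgroup.coe_mul, Equiv.Perm.mul_apply, e]
    exact (isNuclear_of_mem ha).mul (isNuclear_mul_self _)
  have h3 (k : ℕ) : IsNuclear ((((g * g) ^ k : RMlt Q) : Equiv.Perm Q) 1) := by
    induction k with
    | zero => exact isNuclear_one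
    | succ k ih =>
      rw [pow_succ', Subgroup.coe_mul, Equiv.Perm.mul_apply]
      exact isNuclear_map ih h2
  have h4 : IsNuclear ((g : Equiv.Perm Q) 1) := by
    have h5 := map_nuclear_mul g (h3 t) 1
    have h6 := congrArg (fun g : RMlt Q => (g : Equiv.Perm Q) 1) h1
    rw [mul_one] at h5
    rw [pow_succ', pow_mul, pow_two, Subgroup.coe_mul, Equiv.Perm.mul_apply, h5] at h6
    rw [← inv_inv ((g : Equiv.Perm Q) 1)]
    have h7 := eq_mul_inv_of_mul_eq h6
    change _ = 1 * _ at h7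
    rw [one_mul] at h7
    rw [← h7]
    exact (h3 t).inv
  -- `g = g ^ (2 * t + 2)`, and `g²` is the square of a nuclear translation.
  have h5 : g = (rTrans ((g : Equiv.Perm Q) 1) * rTrans ((g : Equiv.Perm Q) 1)) ^ (t + 1) := by
    rw [← mul_self_of_isNuclear_map h4, ← pow_two, ← pow_mul,
      show 2 * (t + 1) = (2 * t + 1) + 1 by ring, pow_succ, h1, _root_.one_mul]
  have h6 : rTrans ((g : Equiv.Perm Q) 1) ∈ translationSubgroup (nucleus Q) (fun _ h => h) :=
    mem_rightTranslationSet.2 ⟨_, h4, rfl⟩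
  have h7 := Subgroup.pow_mem _ (Subgroup.mul_mem _ h6 h6) (t + 1)
  rw [← h5] at h7
  exact mem_rightTranslationSet.1 h7

theorem exists_subloop_of_odd [Finite Q] (K : Subgroup (RMlt Q)) (hK : Odd (Nat.card K)) :
    ∃ S : Subloop Q, rightTranslationSet (S : Set Q) = K := by
  refine ⟨subloopOfSubgroup K fun a b ha hb => ?_, ?_⟩
  · obtain ⟨n, hn, e⟩ := exists_eq_rTrans_of_odd hK hb
    rw [← rTrans_mul_rTrans_of_isNuclear (rTrans_injective e ▸ hn)]
    exact K.mul_mem hb ha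
  · ext g
    rw [mem_rightTranslationSet]
    constructor
    · rintro ⟨a, ha, rfl⟩
      exact ha
    · intro hg
      obtain ⟨n, hn, rfl⟩ := exists_eq_rTrans_of_odd hK hg
      exact ⟨n, hg, rfl⟩

end ExtraLoop

/-! ### Orders and the four bijections. -/

namespace ExtraLoop

/-- Applied with `γ = Set (RMlt Q)`: subloops and subgroups are matched through their underlying
sets of permutations. -/
theorem exists_equiv_of_range_eq {α β γ : Type*} {f : α → γ} {g : β → γ}
    (hf : Function.Injective f) (hg : Function.Injective g) (hfg : ∀ a, ∃ b, g b = f a)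
    (hgf : ∀ b, ∃ a, f a = g b) : ∃ e : α ≃ β, ∀ a, g (e a) = f a := by
  choose e he using hfg
  refine ⟨Equiv.ofBijective e ⟨fun a a' h => hf (by rw [← he, h, he]), fun b => ?_⟩, he⟩
  obtain ⟨a, ha⟩ := hgf b
  exact ⟨a, hg (by rw [he, ha])⟩

variable {Q : Type*} [Loop Q]

theorem card_of_coe_eq_rightTranslationSet {K : Subgroup (RMlt Q)} {S : Subloop Q}
    (h : rightTranslationSet (S : Set Q) = K) : Nat.card K = Nat.card S := by
  rw [← SetLike.coe_sort_coe K, ← h]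
  exact card_rightTranslationSet _

theorem card_of_coe_eq_innerMulRightTranslationSet {K : Subgroup (RMlt Q)} {S : Subloop Q}
    (h : innerMulRightTranslationSet (S : Set Q) = K) :
    Nat.card K = Nat.card (RMltOne Q) * Nat.card S := by
  rw [← SetLike.coe_sort_coe K, ← h]
  exact card_innerMulRightTranslationSet _

theorem factorization_card_RMlt_two [Finite Q] {k : ℕ} (hk : Nat.card (RMltOne Q) = 2 ^ k) :
    (Nat.card (RMlt Q)).factorization 2 = k + (Nat.card Q).factorization 2 := by
  rw [card_RMlt, hk, Nat.factorization_mul (by simp) Nat.card_pos.ne', Finsupp.add_apply,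
    Nat.prime_two.factorization_pow, Finsupp.single_eq_same]

variable [hQ : Fact (IsExtraLoop Q)] [Finite Q]

theorem exists_card_RMltOne_eq : ∃ k : ℕ, Nat.card (RMltOne Q) = 2 ^ k :=
  IsPGroup.iff_card.1 (isPGroup_associatorStarSubgroup.to_le RMltOne_le_associatorStarSubgroup)

theorem exists_card_associatorSubloop_eq : ∃ k : ℕ, Nat.card (associatorSubloop Q) = 2 ^ k := by
  obtain ⟨k, hk⟩ := IsPGroup.iff_card.1 (isPGroup_associatorStarSubgroup (Q := Q))
  have h := card_of_coe_eq_innerMulRightTranslationSet (K := associatorStarSubgroup Q)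
    (S := associatorSubloop Q) rfl
  rw [hk] at h
  obtain ⟨j, -, hj⟩ := (Nat.dvd_prime_pow Nat.prime_two).1 (Dvd.intro_left _ h.symm)
  exact ⟨j, hj⟩

theorem factorization_card_RMlt_of_ne_two {p : ℕ} (hp : p ≠ 2) :
    (Nat.card (RMlt Q)).factorization p = (Nat.card Q).factorization p := by
  obtain ⟨k, hk⟩ := exists_card_RMltOne_eq (Q := Q)
  rw [card_RMlt, hk, Nat.factorization_mul (by simp) Nat.card_pos.ne', Finsupp.add_apply,
    Nat.prime_two.factorization_pow, Finsupp.single_eq_of_ne hp, zero_add]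

theorem associatorSubloop_le_of_card_eq {P : Subloop Q}
    (hP : Nat.card P = 2 ^ (Nat.card Q).factorization 2) : associatorSubloop Q ≤ P := by
  obtain ⟨k, hk⟩ := exists_card_associatorSubloop_eq (Q := Q)
  have h := card_associatorMul P
  rw [hk, hP, ← pow_add] at h
  obtain ⟨j, -, hj⟩ := (Nat.dvd_prime_pow Nat.prime_two).1 (Dvd.intro _ h.symm)
  -- Lagrange holds for a subloop containing `A`: apply it to the preimage subgroup and cancel
  -- `|RMlt₁|`.
  have hdvd : Nat.card (associatorMul P) ∣ Nat.card Q := by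
    have h := Subgroup.card_subgroup_dvd_card
      (fiberSubgroup (associatorMul P) (associatorSubloop_le_associatorMul P))
    rw [card_of_coe_eq_innerMulRightTranslationSet (S := associatorMul P) rfl, card_RMlt] at h
    exact Nat.dvd_of_mul_dvd_mul_left Nat.card_pos h
  have hle : Nat.card (associatorMul P) ≤ Nat.card P := by
    rw [hj, hP]
    rw [hj] at hdvd
    exact Nat.pow_le_pow_right two_pos
      ((Nat.prime_two.pow_dvd_iff_le_factorization Nat.card_pos.ne').1 hdvd)
  have heq : (P : Set Q) = associatorMul P :=
    Set.eq_of_subset_of_ncard_le (le_associatorMul P) hle (Set.toFinite _)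
  intro a ha
  rw [← SetLike.mem_coe, heq]
  exact associatorSubloop_le_associatorMul P ha

theorem exists_sylow_equiv_of_ne_two {p : ℕ} (hp : p.Prime) (h2 : p ≠ 2) :
    ∃ e : SylowSubloop p Q ≃ Sylow p (RMlt Q), ∀ P : SylowSubloop p Q,
      ((e P : Subgroup (RMlt Q)) : Set (RMlt Q)) = rightTranslationSet (P.1 : Set Q) := by
  have := Fact.mk hp
  have hodd : Odd (p ^ (Nat.card Q).factorization p) := (hp.odd_of_ne_two h2).pow
  refine exists_equiv_of_range_eq (g := fun K : Sylow p (RMlt Q) => (K : Set (RMlt Q)))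
    (fun P P' h => Subtype.ext (SetLike.coe_injective (rightTranslationSet_injective h)))
    SetLike.coe_injective (fun P => ?_) (fun K => ?_)
  · have hN : ∀ x ∈ P.1, IsNuclear x := fun x hx =>
      isNuclear_of_odd_card (by rw [P.2]; exact hodd) hx
    have hK : rightTranslationSet (P.1 : Set Q) = translationSubgroup P.1 hN := rfl
    exact ⟨Sylow.ofCard (translationSubgroup P.1 hN) (by
      rw [card_of_coe_eq_rightTranslationSet hK, P.2, factorization_card_RMlt_of_ne_two h2]), rfl⟩
  · have hc := K.card_eq_multiplicity
    rw [factorization_card_RMlt_of_ne_two h2] at hc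
    obtain ⟨S, hS⟩ := exists_subloop_of_odd (K : Subgroup (RMlt Q)) (hc ▸ hodd)
    exact ⟨⟨S, (card_of_coe_eq_rightTranslationSet hS).symm.trans hc⟩, hS⟩

theorem exists_sylow_two_equiv : ∃ e : SylowSubloop 2 Q ≃ Sylow 2 (RMlt Q),
    ∀ P : SylowSubloop 2 Q, ((e P : Subgroup (RMlt Q)) : Set (RMlt Q)) =
      innerMulRightTranslationSet (P.1 : Set Q) := by
  obtain ⟨k, hk⟩ := exists_card_RMltOne_eq (Q := Q)
  refine exists_equiv_of_range_eq (g := fun K : Sylow 2 (RMlt Q) => (K : Set (RMlt Q)))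
    (fun P P' h => Subtype.ext (SetLike.coe_injective (innerMulRightTranslationSet_injective h)))
    SetLike.coe_injective (fun P => ?_) (fun K => ?_)
  · have hK : innerMulRightTranslationSet (P.1 : Set Q) =
      fiberSubgroup P.1 (associatorSubloop_le_of_card_eq P.2) := rfl
    exact ⟨Sylow.ofCard (fiberSubgroup P.1 _) (by
      rw [card_of_coe_eq_innerMulRightTranslationSet hK, P.2, factorization_card_RMlt_two hk, hk,
        pow_add]), rfl⟩
  · have hc := K.card_eq_multiplicity
    obtain ⟨P, -, hP⟩ := exists_subloop_of_associatorStar_subset (K : Subgroup (RMlt Q))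
      (associatorStar_subset_sylow K)
    rw [card_of_coe_eq_innerMulRightTranslationSet hP, factorization_card_RMlt_two hk, hk,
      pow_add] at hc
    exact ⟨⟨P, Nat.eq_of_mul_eq_mul_left (by positivity) hc⟩, hP⟩

theorem exists_odd_equiv :
    ∃ e : {S : Subloop Q // Odd (Nat.card S)} ≃ {G : Subgroup (RMlt Q) // Odd (Nat.card G)},
      ∀ S, ((e S).1 : Set (RMlt Q)) = rightTranslationSet (S.1 : Set Q) := by
  refine exists_equiv_of_range_eq
    (g := fun K : {G : Subgroup (RMlt Q) // Odd (Nat.card G)} => (K.1 : Set (RMlt Q)))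
    (fun P P' h => Subtype.ext (SetLike.coe_injective (rightTranslationSet_injective h)))
    (fun K K' h => Subtype.ext (SetLike.coe_injective h)) (fun S => ?_) (fun K => ?_)
  · have hK : rightTranslationSet (S.1 : Set Q) = translationSubgroup S.1
      (fun x hx => isNuclear_of_odd_card S.2 hx) := rfl
    exact ⟨⟨_, by rw [card_of_coe_eq_rightTranslationSet hK]; exact S.2⟩, rfl⟩
  · obtain ⟨S, hS⟩ := exists_subloop_of_odd K.1 K.2
    exact ⟨⟨S, by rw [← card_of_coe_eq_rightTranslationSet hS]; exact K.2⟩, hS⟩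

theorem exists_two_equiv :
    ∃ e : {P : Subloop Q // (∃ n : ℕ, Nat.card P = 2 ^ n) ∧ associatorSubloop Q ≤ P} ≃
        {G : Subgroup (RMlt Q) //
          (∃ n : ℕ, Nat.card G = 2 ^ n) ∧ associatorStar Q ⊆ (G : Set (RMlt Q))},
      ∀ P, ((e P).1 : Set (RMlt Q)) = innerMulRightTranslationSet (P.1 : Set Q) := by
  obtain ⟨k, hk⟩ := exists_card_RMltOne_eq (Q := Q)
  refine exists_equiv_of_range_eq (g := fun K : {G : Subgroup (RMlt Q) //
      (∃ n : ℕ, Nat.card G = 2 ^ n) ∧ associatorStar Q ⊆ (G : Set (RMlt Q))} =>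
      (K.1 : Set (RMlt Q)))
    (fun P P' h => Subtype.ext (SetLike.coe_injective (innerMulRightTranslationSet_injective h)))
    (fun K K' h => Subtype.ext (SetLike.coe_injective h)) ?_ ?_
  · rintro ⟨P, ⟨n, hn⟩, hA⟩
    have hK : innerMulRightTranslationSet (P : Set Q) = fiberSubgroup P hA := rfl
    refine ⟨⟨fiberSubgroup P hA, ⟨k + n, ?_⟩, fun g hg =>
      mem_fiberSubgroup.2 (hA (mem_associatorStar.1 hg))⟩, rfl⟩
    rw [card_of_coe_eq_innerMulRightTranslationSet hK, hk, hn, pow_add]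
  · rintro ⟨K, ⟨n, hn⟩, hA⟩
    obtain ⟨P, hP, h⟩ := exists_subloop_of_associatorStar_subset K hA
    rw [card_of_coe_eq_innerMulRightTranslationSet h] at hn
    obtain ⟨j, -, hj⟩ := (Nat.dvd_prime_pow Nat.prime_two).1 (Dvd.intro_left _ hn)
    exact ⟨⟨P, ⟨j, hj⟩, hP⟩, h⟩

end ExtraLoop

theorem mainTheorem9 {Q : Type*} [Loop Q] [Finite Q] (hQ : IsExtraLoop Q) :
    -- the correspondence between Sylow subloops and Sylow subgroups
    (∀ p : ℕ, p.Prime → ∃ e : SylowSubloop p Q ≃ Sylow p (RMlt Q), ∀ P : SylowSubloop p Q,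
      (p ≠ 2 → ((e P : Subgroup (RMlt Q)) : Set (RMlt Q)) =
        rightTranslationSet (P.1 : Set Q)) ∧
      (p = 2 → ((e P : Subgroup (RMlt Q)) : Set (RMlt Q)) =
        innerMulRightTranslationSet (P.1 : Set Q))) ∧
    -- subloops and subgroups of odd order
    (∃ e : {S : Subloop Q // Odd (Nat.card S)} ≃ {G : Subgroup (RMlt Q) // Odd (Nat.card G)},
      ∀ S, ((e S).1 : Set (RMlt Q)) = rightTranslationSet (S.1 : Set Q)) ∧
    -- 2-subloops containing `A(Q)` and 2-subgroups containing `A*`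
    (∃ e : {P : Subloop Q // (∃ n : ℕ, Nat.card P = 2 ^ n) ∧ associatorSubloop Q ≤ P} ≃
        {G : Subgroup (RMlt Q) //
          (∃ n : ℕ, Nat.card G = 2 ^ n) ∧ associatorStar Q ⊆ (G : Set (RMlt Q))},
      ∀ P, ((e P).1 : Set (RMlt Q)) = innerMulRightTranslationSet (P.1 : Set Q)) := by
  have := Fact.mk hQ
  refine ⟨fun p hp => ?_, ExtraLoop.exists_odd_equiv, ExtraLoop.exists_two_equiv⟩
  by_cases h2 : p = 2
  · subst h2
    obtain ⟨e, he⟩ := ExtraLoop.exists_sylow_two_equiv (Q := Q)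
    exact ⟨e, fun P => ⟨fun h => absurd rfl h, fun _ => he P⟩⟩
  · obtain ⟨e, he⟩ := ExtraLoop.exists_sylow_equiv_of_ne_two (Q := Q) hp h2
    exact ⟨e, fun P => ⟨fun _ => he P, fun h => absurd h h2⟩⟩
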